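/- Let $G$ be a finite group, let $I$ and $\Lambda$ be finite index sets, and let $P=(p_{\lambda i})$ be a $\Lambda\times I$ matrix with entries in $G^0=G\cup\{0\}$ that is regular (every row and every column contains a non-zero entry) and has at least one zero entry. Let $\mathcal{M}_0[G;I,\Lambda;P]$ be the $0$-Rees matrix semigroup, that is, the set $(I\times G\times\Lambda)\cup\{0\}$ in which $0$ is a zero element, $(i,x,\lambda)(j,y,\mu)=(i,xp_{\lambda j}y,\mu)$ if $p_{\lambda j}\neq 0$, and $(i,x,\lambda)(j,y,\mu)=0$ if $p_{\lambda j}=0$. Let $\mathcal{G}$ be its commuting graph: the vertices are the non-central elements, and two distinct vertices are adjacent if and only if they commute. Let $\chi(\mathcal{G})$ be its chromatic number. For $I'\subseteq I$ and $\Lambda'\subseteq\Lambda$ let $P_{I',\Lambda'}$ be the submatrix of $P$ with columns $I'$ and rows $\Lambda'$. A *$0$-closure submatrix* of $P$ is a submatrix obtained as follows. Start with $Q_0=P_{\{i\},\{\lambda\}}$ for some zero entry $p_{\lambda i}=0$. Given $Q_k=P_{I_k,\Lambda_k}$, mark all zero entries of $P$ that lie in a row or a column intersecting $Q_k$ but not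 in $Q_k$ itself. If there are none, stop, and $Q_k$ is a $0$-closure submatrix. Otherwise let $Q_{k+1}=P_{I_k\cup I',\Lambda_k\cup\Lambda'}$, where $I'$ and $\Lambda'$ are the sets of the indices of the columns and rows that contain marked entries, and continue. 1. Suppose that $\mathcal{G}$ is connected. Let $c$ (respectively, $r$) be the maximum number of zeros in a column (respectively, row) of $P$. (a) If there exist $i\in I$ and $\lambda\in\Lambda$ such that $p_{\lambda i}\in G$, column $i$ of $P$ has $c$ zeros and row $\lambda$ of $P$ has $r$ zeros, then $\chi(\mathcal{G})\leqslant cr|G|$. (b) Otherwise, $\chi(\mathcal{G})\leqslant (cr-1)|G|$. 2. Suppose that $\mathcal{G}$ is not connected. Let $A_1,\ldots,A_n$ be all the $0$-closure submatrices of $P$, where $A_l=P_{I_l,\Lambda_l}$. For each $l$ let $c_l$ (respectively, $r_l$) be the maximum number of zeros in a column (respectively, row) of $A_l$. Let $z_l=c_lr_l$ if all entries of $A_l$ are zero or if there exist $i\in I_l$ and $\lambda\in\Lambda_l$ such that $p_{\lambda i}\in G$, column $i$ of $A_l$ has $c_l$ zeros and row $\lambda$ of $A_l$ has $r_l$ zeros;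 otherwise let $z_l=c_lr_l-1$. Then $\chi(\mathcal{G})\leqslant\max\{2,z_1,\ldots,z_n\}\,|G|$. -/

import Mathlib

/-- A matrix is regular if every row and every column contains a nonzero entry. -/
def IsRegularMatrix {m n α : Type*} [Zero α] (M : Matrix m n α) : Prop :=
  (∀ l, ∃ i, M l i ≠ 0) ∧ (∀ i, ∃ l, M l i ≠ 0)

/-- The underlying set `(I × G × Λ) ∪ {0}` of the 0-Rees matrix semigroup `M₀[G; I, Λ; P]`, where
`P` is a `Λ × I` matrix with entries in `G⁰ = WithZero G`. -/
inductive ReesZero {G I L : Type*} (P : Matrix L I (WithZero G)) where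
  | zero : ReesZero P
  | elem (i : I) (x : G) (l : L) : ReesZero P

namespace ReesZero

variable {G I L : Type*} [Group G] {P : Matrix L I (WithZero G)}

open Classical in
/-- `(i, x, l) (j, y, m)` is `(i, x p_{lj} y, m)` if `p_{lj} ≠ 0`, and `0` if `p_{lj} = 0`; all
products with a factor `0` are `0`. -/
noncomputable def mul : ReesZero P → ReesZero P → ReesZero P
  | elem i x l, elem j y m =>
      if h : P l j = 0 then zero else elem i (x * WithZero.unzero h * y) m
  | zero, _ => zero
  | elem _ _ _, zero => zero

noncomputable instance : Semigroup (ReesZero P) where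
  mul := mul
  mul_assoc a b c := by
    change mul (mul a b) c = mul a (mul b c)
    rcases a with _ | ⟨i, x, l⟩ <;> rcases b with _ | ⟨j, y, m⟩ <;>
      rcases c with _ | ⟨k, z, n⟩ <;> simp only [mul]
    all_goals
      by_cases h : P l j = 0 <;> simp [h]
    all_goals
      by_cases h' : P m k = 0 <;> simp [h, h', mul_assoc]

end ReesZero

/-- The commuting graph of a semigroup: the vertices are the non-central elements, and two distinct
vertices are adjacent if and only if they commute. -/
def commutingGraph (S : Type*) [Semigroup S] : SimpleGraph {x : S // x ∉ Set.center S} where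
  Adj x y := x ≠ y ∧ (x : S) * y = y * x
  symm := ⟨fun _ _ h => ⟨h.1.symm, h.2.symm⟩⟩
  loopless := ⟨fun _ h => h.1 rfl⟩

section ZeroClosure

variable {I L α : Type*} [Fintype I] [Fintype L] [Zero α]

open Classical in
/-- A submatrix of `P` is given by the pair `Q = (I', L')` of its sets of column and row indices.
The marked entries are the zero entries `(l, i)` of `P` that lie in a row or a column
intersecting the submatrix, but not in the submatrix itself. -/
noncomputable def markedZeros (P : Matrix L I α) (Q : Finset I × Finset L) : Finset (L × I) :=
  {e | P e.1 e.2 = 0 ∧ (e.1 ∈ Q.2 ∨ e.2 ∈ Q.1) ∧ ¬ (e.1 ∈ Q.2 ∧ e.2 ∈ Q.1)}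

open Classical in
/-- One step of the 0-closure method: adjoin all columns and rows that contain marked entries. -/
noncomputable def zeroClosureStep (P : Matrix L I α) (Q : Finset I × Finset L) :
    Finset I × Finset L :=
  (Q.1 ∪ (markedZeros P Q).image Prod.snd, Q.2 ∪ (markedZeros P Q).image Prod.fst)

/-- `Q` is (the pair of index sets of) a 0-closure submatrix of `P`: the 0-closure method, started
at some zero entry `(l, i)` of `P`, halts at `Q`. -/
def IsZeroClosure (P : Matrix L I α) (Q : Finset I × Finset L) : Prop :=
  ∃ i l, P l i = 0 ∧
    ∃ k : ℕ, (zeroClosureStep P)^[k] ({i}, {l}) = Q ∧ markedZeros P Q = ∅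

open Classical in
/-- The finite set of all 0-closure submatrices of `P`. -/
noncomputable def zeroClosures (P : Matrix L I α) : Finset (Finset I × Finset L) :=
  {Q | IsZeroClosure P Q}

/-- The submatrix of `P` with columns `Q.1` and rows `Q.2`. -/
def blockSubmatrix (P : Matrix L I α) (Q : Finset I × Finset L) : Matrix Q.2 Q.1 α :=
  P.submatrix Subtype.val Subtype.val

open Classical in
/-- The number of zeros in column `i`. -/
noncomputable def colZeros (P : Matrix L I α) (i : I) : ℕ :=
  Finset.card {l | P l i = 0}

open Classical in
/-- The number of zeros in row `l`. -/
noncomputable def rowZeros (P : Matrix L I α) (l : L) : ℕ :=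
  Finset.card {i | P l i = 0}

/-- The maximum number of zeros in a column. -/
noncomputable def maxColZeros (P : Matrix L I α) : ℕ :=
  Finset.univ.sup (colZeros P)

/-- The maximum number of zeros in a row. -/
noncomputable def maxRowZeros (P : Matrix L I α) : ℕ :=
  Finset.univ.sup (rowZeros P)

/-- Some nonzero entry lies both in a column with the maximum number of zeros and in a row with the
maximum number of zeros. -/
def HasNonzeroAtMax (P : Matrix L I α) : Prop :=
  ∃ i l, P l i ≠ 0 ∧ colZeros P i = maxColZeros P ∧ rowZeros P l = maxRowZeros P

open Classical in
/-- The number `z` attached to a matrix `A` with maximum numbers of zeros `c` in a column and `r` in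
a row: `c r` if `A` is a zero matrix or has a nonzero entry in a column with `c` zeros and a row
with `r` zeros, and `c r - 1` otherwise. (For a 0-closure submatrix `c, r ≥ 1`, so that the
subtraction is not truncated.) -/
noncomputable def degreeBound (A : Matrix L I α) : ℕ :=
  if A = 0 ∨ HasNonzeroAtMax A then maxColZeros A * maxRowZeros A
  else maxColZeros A * maxRowZeros A - 1

end ZeroClosure

/-! ### Greedy colouring -/

section Colouring

/-! If `(i, x, l)` and `(j, y, m)` commute, then either `(i, l) = (j, m)` or `p_{lj} = p_{mi} = 0`.
So a `k`-colouring of `pairGraph P`, a graph on positions only, paired with the group coordinate,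
colours the commuting graph with `k |G|` colours (`chromaticNumber_commutingGraph_le`).

The neighbours of a position `v` lie in `crossZeros`, a product set with at most `cr` elements. When
the bipartite graph `zeroGraph` of zero entries is connected, a greedy colouring in a suitable order
leaves fewer than `cr` relevant neighbours. A zero position lies in its own product set but is not
its own neighbour, while a nonzero position has a neighbour whose indices are strictly closer in
`zeroGraph`, which the order excludes. If no nonzero entry attains both maxima, putting the zero
positions first saves one more colour (`pairGraph_colorable_mul_sub_one`).

In general the 0-closures are the components of `zeroGraph` that have an edge. A position with both
indices in one closure has neighbours only in that block. A position across two components has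
neighbours only across the same two, with the roles swapped, so two colours suffice there
(`pairGraph_colorable`). If the commuting graph is connected, so is `zeroGraph`
(`zeroGraph_preconnected`). -/

open Classical in
theorem SimpleGraph.colorable_of_forall_exists_card_lt {V : Type*} [Fintype V]
    (H : SimpleGraph V) (k : ℕ)
    (h : ∀ S : Finset V, S.Nonempty → ∃ v ∈ S, Finset.card {u ∈ S | H.Adj v u} < k) :
    H.Colorable k := by
  have key : ∀ n : ℕ, ∀ S : Finset V, S.card = n →
      ∃ f : V → ℕ, ∀ u ∈ S, f u < k ∧ ∀ v ∈ S, H.Adj u v → f u ≠ f v := by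
    intro n
    induction n with
    | zero =>
      intro S hS
      rw [Finset.card_eq_zero] at hS
      subst hS
      exact ⟨fun _ => 0, by simp⟩
    | succ n ih =>
      intro S hS
      obtain ⟨v, hv, hlt⟩ := h S (Finset.card_pos.mp (by omega))
      obtain ⟨f, hf⟩ := ih (S.erase v) (by rw [Finset.card_erase_of_mem hv]; omega)
      -- The fewer than `k` neighbours of `v` in `S` leave one of the `k` colours free.
      have hne : ∃ c ∈ Finset.range k, c ∉ ({u ∈ S | H.Adj v u} : Finset V).image f := by
        by_contra! hcon
        have h1 := Finset.card_le_card (show Finset.range k ⊆ _ from hcon)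
        have h2 := Finset.card_image_le (s := ({u ∈ S | H.Adj v u} : Finset V)) (f := f)
        rw [Finset.card_range] at h1
        omega
      obtain ⟨c, hck, hc⟩ := hne
      rw [Finset.mem_range] at hck
      have hc' : ∀ u ∈ S, H.Adj v u → f u ≠ c := fun u hu huv he =>
        hc (Finset.mem_image.mpr ⟨u, by simp [hu, huv], he⟩)
      refine ⟨Function.update f v c, fun u hu => ?_⟩
      by_cases huv : u = v
      · subst huv
        refine ⟨by simpa using hck, fun w hw hadj => ?_⟩
        rw [Function.update_self, Function.update_of_ne hadj.ne.symm]
        exact (hc' w hw hadj).symm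
      · have hu' := hf u (Finset.mem_erase.mpr ⟨huv, hu⟩)
        rw [Function.update_of_ne huv]
        refine ⟨hu'.1, fun w hw hadj => ?_⟩
        by_cases hwv : w = v
        · subst hwv
          rw [Function.update_self]
          exact hc' u hu hadj.symm
        · rw [Function.update_of_ne hwv]
          exact hu'.2 w (Finset.mem_erase.mpr ⟨hwv, hw⟩) hadj
  obtain ⟨f, hf⟩ := key _ Finset.univ rfl
  exact ⟨SimpleGraph.Coloring.mk (fun v => (⟨f v, (hf v (Finset.mem_univ v)).1⟩ : Fin k))
    fun {u v} huv he => (hf u (Finset.mem_univ u)).2 v (Finset.mem_univ v) huv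
      (congrArg Fin.val he)⟩

-- In any nonempty set, a vertex of largest weight has only neighbours of at most its own weight, so
-- the count in the hypothesis bounds its degree within the set.
open Classical in
theorem SimpleGraph.colorable_of_weight {V β : Type*} [Fintype V] [LinearOrder β]
    (H : SimpleGraph V) (k : ℕ) (w : V → β)
    (h : ∀ v, Finset.card {u | H.Adj v u ∧ w u ≤ w v} < k) : H.Colorable k := by
  refine H.colorable_of_forall_exists_card_lt k fun S hS => ?_
  obtain ⟨v, hv, hmax⟩ := S.exists_max_image w hS
  refine ⟨v, hv, lt_of_le_of_lt (Finset.card_le_card fun u hu => ?_) (h v)⟩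
  rw [Finset.mem_filter] at hu
  simpa using ⟨hu.2, hmax u hu.1⟩

end Colouring

/-! ### The bipartite graph of zero entries -/

section ZeroGraph

variable {I L α : Type*} [Zero α]

/-- The bipartite graph on column and row indices whose edges are the zero entries. -/
def zeroGraph (A : Matrix L I α) : SimpleGraph (I ⊕ L) where
  Adj
    | .inl i, .inr l => A l i = 0
    | .inr l, .inl i => A l i = 0
    | _, _ => False
  symm := ⟨by rintro (i | l) (j | m) h <;> exact h⟩
  loopless := ⟨by rintro (i | l) h <;> exact h⟩

@[simp] theorem zeroGraph_adj_inl_inr {A : Matrix L I α} {i : I} {l : L} :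
    (zeroGraph A).Adj (.inl i) (.inr l) ↔ A l i = 0 := Iff.rfl

@[simp] theorem zeroGraph_adj_inr_inl {A : Matrix L I α} {i : I} {l : L} :
    (zeroGraph A).Adj (.inr l) (.inl i) ↔ A l i = 0 := Iff.rfl

@[simp] theorem not_zeroGraph_adj_inl_inl {A : Matrix L I α} {i j : I} :
    ¬ (zeroGraph A).Adj (.inl i) (.inl j) := id

@[simp] theorem not_zeroGraph_adj_inr_inr {A : Matrix L I α} {l m : L} :
    ¬ (zeroGraph A).Adj (.inr l) (.inr m) := id

/-- The graph on the positions of a matrix in which `(i, l)` and `(j, m)` are adjacent when the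
entries at `(l, j)` and `(m, i)` vanish. -/
def pairGraph (A : Matrix L I α) : SimpleGraph (I × L) where
  Adj u v := u ≠ v ∧ A u.2 v.1 = 0 ∧ A v.2 u.1 = 0
  symm := ⟨fun _ _ h => ⟨h.1.symm, h.2.2, h.2.1⟩⟩
  loopless := ⟨fun _ h => h.1 rfl⟩

theorem SimpleGraph.Reachable.induction_adj {V : Type*} {H : SimpleGraph V} {a b : V}
    (hab : H.Reachable a b) (p : V → Prop) (ha : p a) (h : ∀ x y, H.Adj x y → p x → p y) :
    p b := by
  obtain ⟨W⟩ := hab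
  induction W with
  | nil => exact ha
  | cons hadj _ ih => exact ih (h _ _ hadj ha)

/-- If `i` and `l` are connected in the zero graph and the entry `(l, i)` is nonzero, a neighbour of
`(i, l)` in the pair graph is closer together. -/
theorem exists_zeroGraph_dist_lt {A : Matrix L I α} {i : I} {l : L}
    (h : (zeroGraph A).Reachable (.inl i) (.inr l)) (hne : A l i ≠ 0) :
    ∃ j m, A l j = 0 ∧ A m i = 0 ∧
      (zeroGraph A).dist (.inl j) (.inr m) < (zeroGraph A).dist (.inl i) (.inr l) := by
  -- Both end edges are cut off a shortest path `i, m, …, j, l`; reversing the tail exposes its last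
  -- edge. A path of length one would make the entry zero.
  obtain ⟨W, hW⟩ := h.exists_walk_length_eq_dist
  rw [← hW]
  cases W with
  | @cons _ b _ hb W' =>
    obtain _ | m := b
    · simp at hb
    rw [SimpleGraph.Walk.length_cons, ← SimpleGraph.Walk.length_reverse W']
    generalize W'.reverse = R
    cases R with
    | nil => exact absurd hb hne
    | @cons _ d _ hd R' =>
      obtain j | _ := d
      · refine ⟨j, m, hd, hb, ?_⟩
        have := SimpleGraph.dist_le R'
        rw [SimpleGraph.Walk.length_cons]
        omega
      · simp at hd

end ZeroGraph

/-! ### Colouring positions when the zero graph is connected -/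

section Bounds

variable {I L α : Type*} [Fintype I] [Fintype L] [Zero α]

theorem colZeros_le_max (A : Matrix L I α) (i : I) : colZeros A i ≤ maxColZeros A :=
  Finset.le_sup (f := colZeros A) (Finset.mem_univ i)

theorem rowZeros_le_max (A : Matrix L I α) (l : L) : rowZeros A l ≤ maxRowZeros A :=
  Finset.le_sup (f := rowZeros A) (Finset.mem_univ l)

open Classical in
/-- The positions `(j, m)` with zero entries at `(l, j)` and `(m, i)`. -/
noncomputable def crossZeros (A : Matrix L I α) (v : I × L) : Finset (I × L) :=
  ({j | A v.2 j = 0} : Finset I) ×ˢ ({m | A m v.1 = 0} : Finset L)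

theorem mem_crossZeros {A : Matrix L I α} {u v : I × L} :
    u ∈ crossZeros A v ↔ A v.2 u.1 = 0 ∧ A u.2 v.1 = 0 := by
  simp [crossZeros]

theorem card_crossZeros (A : Matrix L I α) (v : I × L) :
    (crossZeros A v).card = rowZeros A v.2 * colZeros A v.1 := by
  simp only [crossZeros, Finset.card_product, rowZeros, colZeros]

theorem card_crossZeros_le (A : Matrix L I α) (v : I × L) :
    (crossZeros A v).card ≤ maxColZeros A * maxRowZeros A := by
  rw [card_crossZeros, mul_comm]
  exact Nat.mul_le_mul (colZeros_le_max A _) (rowZeros_le_max A _)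

/-- Starting from row `l₀`, one reaches columns with a zero in that row, and each has no further
zero by which to leave it. By connectedness `l₀` is the only row and every column meets it in a
zero. -/
theorem eq_zero_of_maxColZeros_le_one {A : Matrix L I α} (hA : (zeroGraph A).Preconnected)
    {i₀ : I} {l₀ : L} (h₀ : A l₀ i₀ = 0) (hc : maxColZeros A ≤ 1) : A = 0 := by
  classical
  have key : ∀ b, Sum.elim (fun i => A l₀ i = 0) (fun l => l = l₀) b := fun b =>
    (hA (.inr l₀) b).induction_adj _ rfl (by
      rintro (i | l) (j | m) hadj hx
      · simp at hadj
      · have h1 := (colZeros_le_max A i).trans hc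
        rw [colZeros, Finset.card_le_one] at h1
        exact h1 m (by simpa using hadj) l₀ (by simpa using hx)
      · change l = l₀ at hx
        subst hx
        exact hadj
      · simp at hadj)
  ext l i
  have h1 : l = l₀ := key (.inr l)
  rw [h1]
  exact key (.inl i)

theorem eq_zero_of_maxRowZeros_le_one {A : Matrix L I α} (hA : (zeroGraph A).Preconnected)
    {i₀ : I} {l₀ : L} (h₀ : A l₀ i₀ = 0) (hr : maxRowZeros A ≤ 1) : A = 0 := by
  classical
  have key : ∀ b, Sum.elim (fun i => i = i₀) (fun l => A l i₀ = 0) b := fun b =>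
    (hA (.inl i₀) b).induction_adj _ rfl (by
      rintro (i | l) (j | m) hadj hx
      · simp at hadj
      · change i = i₀ at hx
        subst hx
        exact hadj
      · have h1 := (rowZeros_le_max A l).trans hr
        rw [rowZeros, Finset.card_le_one] at h1
        exact h1 j (by simpa using hadj) i₀ (by simpa using hx)
      · simp at hadj)
  ext l i
  have h1 : i = i₀ := key (.inl i)
  rw [h1]
  exact key (.inr l)

/-- A zero entry in a row and a column with the maximum numbers of zeros, all of whose cross zeros
are zero entries, forces the matrix to vanish. -/
theorem eq_zero_of_crossZeros {A : Matrix L I α} (hA : (zeroGraph A).Preconnected) {v : I × L}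
    (hv : A v.2 v.1 = 0) (hall : ∀ u ∈ crossZeros A v, A u.2 u.1 = 0)
    (hrow : rowZeros A v.2 = maxRowZeros A) (hcol : colZeros A v.1 = maxColZeros A) : A = 0 := by
  classical
  obtain ⟨i₀, l₀⟩ := v
  simp only [mem_crossZeros, Prod.forall] at hall
  simp only at hrow hcol hv
  -- The zeros of column `i` include those of column `i₀`; as `i₀` has the maximum number, the two
  -- sets agree.
  have hcolsub : ∀ i, A l₀ i = 0 → ∀ l, A l i = 0 → A l i₀ = 0 := by
    intro i hi l hl
    have hsub : ({l | A l i₀ = 0} : Finset L) ⊆ ({l | A l i = 0} : Finset L) := fun m hm => by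
      simp only [Finset.mem_filter, Finset.mem_univ, true_and] at hm ⊢
      exact hall i m ⟨hi, hm⟩
    have heq := Finset.eq_of_subset_of_card_le hsub (by
      have := colZeros_le_max A i
      rw [← hcol] at this
      simpa only [colZeros] using this)
    have : l ∈ ({l | A l i₀ = 0} : Finset L) := by rw [heq]; simpa using hl
    simpa using this
  have hrowsub : ∀ l, A l i₀ = 0 → ∀ i, A l i = 0 → A l₀ i = 0 := by
    intro l hl i hi
    have hsub : ({i | A l₀ i = 0} : Finset I) ⊆ ({i | A l i = 0} : Finset I) := fun j hj => by
      simp only [Finset.mem_filter, Finset.mem_univ, true_and] at hj ⊢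
      exact hall j l ⟨hj, hl⟩
    have heq := Finset.eq_of_subset_of_card_le hsub (by
      have := rowZeros_le_max A l
      rw [← hrow] at this
      simpa only [rowZeros] using this)
    have : i ∈ ({i | A l₀ i = 0} : Finset I) := by rw [heq]; simpa using hi
    simpa using this
  -- The columns with a zero in row `l₀` and the rows with a zero in column `i₀` are thus closed
  -- under adjacency, hence exhaust all indices.
  have key : ∀ b, Sum.elim (fun i => A l₀ i = 0) (fun l => A l i₀ = 0) b := fun b =>
    (hA (.inl i₀) b).induction_adj _ hv (by
      rintro (i | l) (j | m) hadj hx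
      · simp at hadj
      · exact hcolsub i hx m hadj
      · exact hrowsub l hx j hadj
      · simp at hadj)
  ext l i
  exact hall i l ⟨key (.inl i), key (.inr l)⟩

theorem pairGraph_colorable_of_eq_zero {A : Matrix L I α} (hA : A = 0) :
    (pairGraph A).Colorable (maxColZeros A * maxRowZeros A) := by
  classical
  subst hA
  refine SimpleGraph.colorable_of_weight _ _ (fun _ => 0) fun v => ?_
  refine lt_of_lt_of_le (Finset.card_lt_card ?_) (card_crossZeros_le (0 : Matrix L I α) v)
  rw [Finset.ssubset_iff_of_subset fun u hu => by simp [mem_crossZeros]]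
  exact ⟨v, by simp [mem_crossZeros], by simp⟩

/-- The weight is minus the distance between the two indices, so neighbours that are strictly closer
together do not count. It remains to find one element of `crossZeros A v` that is not counted. -/
theorem pairGraph_colorable_mul {A : Matrix L I α} (hA : (zeroGraph A).Preconnected) :
    (pairGraph A).Colorable (maxColZeros A * maxRowZeros A) := by
  classical
  refine SimpleGraph.colorable_of_weight _ _
    (fun v => -((zeroGraph A).dist (.inl v.1) (.inr v.2) : ℤ)) fun v => ?_
  refine lt_of_lt_of_le (Finset.card_lt_card ?_) (card_crossZeros_le A v)
  rw [Finset.ssubset_iff_of_subset fun u hu => by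
    simp only [Finset.mem_filter] at hu
    exact mem_crossZeros.mpr hu.2.1.2]
  by_cases hv : A v.2 v.1 = 0
  · exact ⟨v, by simp [mem_crossZeros, hv], by simp⟩
  · obtain ⟨j, m, hj, hm, hlt⟩ := exists_zeroGraph_dist_lt (hA _ _) hv
    refine ⟨(j, m), mem_crossZeros.mpr ⟨hj, hm⟩, fun hmem => ?_⟩
    simp only [Finset.mem_filter] at hmem
    have := hmem.2.2
    omega

theorem pairGraph_colorable_mul_sub_one {A : Matrix L I α} (hA : (zeroGraph A).Preconnected)
    (hzero : ∃ l i, A l i = 0) (hne : A ≠ 0) (hmax : ¬ HasNonzeroAtMax A) :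
    (pairGraph A).Colorable (maxColZeros A * maxRowZeros A - 1) := by
  classical
  obtain ⟨l₀, i₀, h₀⟩ := hzero
  have hc : 2 ≤ maxColZeros A := by
    by_contra! h
    exact hne (eq_zero_of_maxColZeros_le_one hA h₀ (by omega))
  have hr : 2 ≤ maxRowZeros A := by
    by_contra! h
    exact hne (eq_zero_of_maxRowZeros_le_one hA h₀ (by omega))
  have hcr : 2 * 2 ≤ maxColZeros A * maxRowZeros A := Nat.mul_le_mul hc hr
  refine SimpleGraph.colorable_of_weight _ _
    (fun v => if A v.2 v.1 = 0 then 0 else 1) fun v => ?_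
  have hrv := rowZeros_le_max A v.2
  have hcv := colZeros_le_max A v.1
  have hB := card_crossZeros_le A v
  by_cases hv : A v.2 v.1 = 0
  -- Only zero positions count against `v`, and `v` itself, an element of `Z`, does not.
  · set Z := (crossZeros A v).filter (fun u => A u.2 u.1 = 0) with hZ
    have hF : Finset.card {u | (pairGraph A).Adj v u ∧
        (if A u.2 u.1 = 0 then 0 else 1) ≤ if A v.2 v.1 = 0 then 0 else 1} < Z.card := by
      refine Finset.card_lt_card ((Finset.ssubset_iff_of_subset fun u hu => ?_).mpr
        ⟨v, by simp [hZ, mem_crossZeros, hv], by simp⟩)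
      simp only [Finset.mem_filter, hv, if_true] at hu
      rw [hZ, Finset.mem_filter, mem_crossZeros]
      refine ⟨hu.2.1.2, ?_⟩
      by_contra hu0
      simpa [hu0] using hu.2.2
    -- Equality would force both maxima at `v` and zeros throughout its cross, hence `A = 0`.
    have hlt : Z.card < maxColZeros A * maxRowZeros A := by
      by_contra! hge
      have hle : Z.card ≤ (crossZeros A v).card := Finset.card_filter_le _ _
      have hall := Finset.card_filter_eq_iff.mp
        (le_antisymm hle (by omega) : Z.card = (crossZeros A v).card)
      have hcard : rowZeros A v.2 * colZeros A v.1 = maxColZeros A * maxRowZeros A := by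
        rw [← card_crossZeros]; omega
      refine hne (eq_zero_of_crossZeros hA hv hall ?_ ?_)
      · by_contra hh
        have : rowZeros A v.2 < maxRowZeros A := lt_of_le_of_ne hrv hh
        nlinarith
      · by_contra hh
        have : colZeros A v.1 < maxColZeros A := lt_of_le_of_ne hcv hh
        nlinarith
    omega
  · have hF : Finset.card {u | (pairGraph A).Adj v u ∧
        (if A u.2 u.1 = 0 then 0 else 1) ≤ if A v.2 v.1 = 0 then 0 else 1} ≤
        (crossZeros A v).card := Finset.card_le_card fun u hu => by
      simp only [Finset.mem_filter] at hu
      exact mem_crossZeros.mpr hu.2.1.2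
    rw [card_crossZeros] at hF
    -- One factor falls short of its maximum and the maximum of the other is at least 2, so the
    -- product loses at least 2.
    have hlt : rowZeros A v.2 * colZeros A v.1 + 2 ≤ maxColZeros A * maxRowZeros A := by
      by_cases hcol : colZeros A v.1 = maxColZeros A
      · have hrow : rowZeros A v.2 < maxRowZeros A :=
          lt_of_le_of_ne hrv fun hh => hmax ⟨v.1, v.2, hv, hcol, hh⟩
        nlinarith
      · have hcol' : colZeros A v.1 < maxColZeros A := lt_of_le_of_ne hcv hcol
        nlinarith
    omega

theorem pairGraph_colorable_degreeBound {A : Matrix L I α} (hA : (zeroGraph A).Preconnected)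
    (hzero : ∃ l i, A l i = 0) : (pairGraph A).Colorable (degreeBound A) := by
  unfold degreeBound
  split_ifs with h
  · exact pairGraph_colorable_mul hA
  · push Not at h
    exact pairGraph_colorable_mul_sub_one hA hzero h.1 h.2

end Bounds

/-! ### 0-closures as components of the zero graph -/

section Closure

variable {I L α : Type*} [Fintype I] [Fintype L] [Zero α] {P : Matrix L I α}

/-- Membership of a column or row index in a pair of index sets. -/
def indexMem (Q : Finset I × Finset L) : I ⊕ L → Prop :=
  Sum.elim (· ∈ Q.1) (· ∈ Q.2)

/-- Where nothing is marked, no zero entry has exactly one of its two indices in `Q`, so no edge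
leaves `Q`. -/
theorem indexMem_iff_of_adj {Q : Finset I × Finset L} (hQ : markedZeros P Q = ∅) {x y : I ⊕ L}
    (h : (zeroGraph P).Adj x y) : indexMem Q x ↔ indexMem Q y := by
  have key : ∀ l i, P l i = 0 → (l ∈ Q.2 ↔ i ∈ Q.1) := by
    intro l i hli
    have hnot : (l, i) ∉ markedZeros P Q := by simp [hQ]
    simp only [markedZeros, Finset.mem_filter, Finset.mem_univ, true_and, hli] at hnot
    tauto
  obtain i | l := x <;> obtain j | m := y
  · simp at h
  · exact (key m i h).symm
  · exact key l j h
  · simp at h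

theorem reachable_of_indexMem_iterate {i : I} {l : L} (hil : P l i = 0) (k : ℕ) (x : I ⊕ L)
    (hx : indexMem ((zeroClosureStep P)^[k] ({i}, {l})) x) :
    (zeroGraph P).Reachable (.inl i) x := by
  induction k generalizing x with
  | zero =>
    obtain j | m := x
    · have : j = i := by simpa [indexMem] using hx
      subst this
      exact SimpleGraph.Reachable.refl _
    · have : m = l := by simpa [indexMem] using hx
      subst this
      exact SimpleGraph.Adj.reachable hil
  | succ k ih =>
    rw [Function.iterate_succ_apply'] at hx
    set Q := (zeroClosureStep P)^[k] ({i}, {l})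
    have hmark : ∀ e ∈ markedZeros P Q, (zeroGraph P).Reachable (.inl i) (.inl e.2) ∧
        (zeroGraph P).Reachable (.inl i) (.inr e.1) := by
      intro e he
      simp only [markedZeros, Finset.mem_filter, Finset.mem_univ, true_and] at he
      have hadj : (zeroGraph P).Adj (.inl e.2) (.inr e.1) := he.1
      rcases he.2.1 with h | h
      · have := ih (.inr e.1) h
        exact ⟨this.trans hadj.symm.reachable, this⟩
      · have := ih (.inl e.2) h
        exact ⟨this, this.trans hadj.reachable⟩
    obtain j | m := x
    · simp only [indexMem, Sum.elim_inl, zeroClosureStep, Finset.mem_union,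
        Finset.mem_image] at hx
      rcases hx with h | ⟨e, he, rfl⟩
      · exact ih (.inl j) h
      · exact (hmark e he).1
    · simp only [indexMem, Sum.elim_inr, zeroClosureStep, Finset.mem_union,
        Finset.mem_image] at hx
      rcases hx with h | ⟨e, he, rfl⟩
      · exact ih (.inr m) h
      · exact (hmark e he).2

open Classical in
theorem subset_zeroClosureStep (P : Matrix L I α) (Q : Finset I × Finset L) :
    Q.1 ⊆ (zeroClosureStep P Q).1 ∧ Q.2 ⊆ (zeroClosureStep P Q).2 :=
  ⟨fun _ h => Finset.mem_union.mpr (.inl h), fun _ h => Finset.mem_union.mpr (.inl h)⟩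

theorem indexMem_iterate {i : I} {l : L} (k : ℕ) :
    indexMem ((zeroClosureStep P)^[k] ({i}, {l})) (.inl i) ∧
      indexMem ((zeroClosureStep P)^[k] ({i}, {l})) (.inr l) := by
  induction k with
  | zero => simp [indexMem]
  | succ k ih =>
    rw [Function.iterate_succ_apply']
    exact ⟨(subset_zeroClosureStep P _).1 ih.1, (subset_zeroClosureStep P _).2 ih.2⟩

theorem card_lt_zeroClosureStep {Q : Finset I × Finset L} (h : markedZeros P Q ≠ ∅) :
    Q.1.card + Q.2.card < (zeroClosureStep P Q).1.card + (zeroClosureStep P Q).2.card := by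
  classical
  have hsub := subset_zeroClosureStep P Q
  have h1 := Finset.card_le_card hsub.1
  have h2 := Finset.card_le_card hsub.2
  by_contra! hcon
  have e1 := Finset.eq_of_subset_of_card_le hsub.1 (by omega)
  have e2 := Finset.eq_of_subset_of_card_le hsub.2 (by omega)
  obtain ⟨e, he⟩ := Finset.nonempty_iff_ne_empty.mpr h
  have m1 : e.2 ∈ Q.1 := by
    rw [e1]
    exact Finset.mem_union_right _ (Finset.mem_image_of_mem Prod.snd he)
  have m2 : e.1 ∈ Q.2 := by
    rw [e2]
    exact Finset.mem_union_right _ (Finset.mem_image_of_mem Prod.fst he)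
  simp only [markedZeros, Finset.mem_filter] at he
  exact he.2.2.2 ⟨m2, m1⟩

theorem exists_iterate_markedZeros_eq_empty (P : Matrix L I α) (Q : Finset I × Finset L) :
    ∃ k, markedZeros P ((zeroClosureStep P)^[k] Q) = ∅ := by
  by_contra! h
  have hcard : ∀ k, k ≤ ((zeroClosureStep P)^[k] Q).1.card + ((zeroClosureStep P)^[k] Q).2.card := by
    intro k
    induction k with
    | zero => exact Nat.zero_le _
    | succ k ih =>
      have := card_lt_zeroClosureStep (Finset.nonempty_iff_ne_empty.mp (h k))
      rw [Function.iterate_succ_apply']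
      omega
  -- This many strict increases exceed the total number of indices.
  have h1 := hcard (Fintype.card I + Fintype.card L + 1)
  have h2 := Finset.card_le_univ
    ((zeroClosureStep P)^[Fintype.card I + Fintype.card L + 1] Q).1
  have h3 := Finset.card_le_univ
    ((zeroClosureStep P)^[Fintype.card I + Fintype.card L + 1] Q).2
  omega

theorem exists_isZeroClosure {i : I} {l : L} (hil : P l i = 0) :
    ∃ Q, IsZeroClosure P Q ∧ indexMem Q (.inl i) ∧ indexMem Q (.inr l) := by
  obtain ⟨k, hk⟩ := exists_iterate_markedZeros_eq_empty P ({i}, {l})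
  exact ⟨_, ⟨i, l, hil, k, rfl, hk⟩, indexMem_iterate k⟩

namespace IsZeroClosure

variable {Q : Finset I × Finset L}

theorem indexMem_iff (hQ : IsZeroClosure P Q) {x y : I ⊕ L}
    (h : (zeroGraph P).Reachable x y) : indexMem Q x ↔ indexMem Q y := by
  obtain ⟨_, _, _, _, _, hm⟩ := hQ
  exact h.induction_adj (fun z => indexMem Q x ↔ indexMem Q z) Iff.rfl
    fun a b hab ih => ih.trans (indexMem_iff_of_adj hm hab)

theorem reachable (hQ : IsZeroClosure P Q) {x y : I ⊕ L} (hx : indexMem Q x)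
    (hy : indexMem Q y) : (zeroGraph P).Reachable x y := by
  obtain ⟨i, l, hil, k, rfl, -⟩ := hQ
  exact (reachable_of_indexMem_iterate hil k x hx).symm.trans
    (reachable_of_indexMem_iterate hil k y hy)

/-- Both closures are the whole component of `x`. -/
theorem eq_of_indexMem (hQ : IsZeroClosure P Q) {Q' : Finset I × Finset L}
    (hQ' : IsZeroClosure P Q') {x : I ⊕ L} (hx : indexMem Q x) (hx' : indexMem Q' x) :
    Q = Q' := by
  have key : ∀ y, indexMem Q y ↔ indexMem Q' y := fun y =>
    ⟨fun hy => (hQ'.indexMem_iff (hQ.reachable hx hy)).mp hx',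
      fun hy => (hQ.indexMem_iff (hQ'.reachable hx' hy)).mp hx⟩
  exact Prod.ext (Finset.ext fun i => key (.inl i)) (Finset.ext fun l => key (.inr l))

theorem exists_zero (hQ : IsZeroClosure P Q) : ∃ l i, blockSubmatrix P Q l i = 0 := by
  obtain ⟨i, l, hil, k, rfl, -⟩ := hQ
  exact ⟨⟨l, (indexMem_iterate k).2⟩, ⟨i, (indexMem_iterate k).1⟩, hil⟩

theorem preconnected (hQ : IsZeroClosure P Q) :
    (zeroGraph (blockSubmatrix P Q)).Preconnected := by
  let ι : Q.1 ⊕ Q.2 → I ⊕ L := Sum.map Subtype.val Subtype.val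
  have hι : ∀ x, indexMem Q (ι x) := by
    rintro (i | l)
    · exact i.2
    · exact l.2
  have hinj : Function.Injective ι :=
    Subtype.val_injective.sumMap Subtype.val_injective
  have hadj : ∀ a b, (zeroGraph P).Adj (ι a) (ι b) → (zeroGraph (blockSubmatrix P Q)).Adj a b := by
    rintro (i | l) (j | m) h <;> exact h
  have hsurj : ∀ y, indexMem Q y → ∃ b, ι b = y := by
    rintro (i | l) hy
    · exact ⟨.inl ⟨i, hy⟩, rfl⟩
    · exact ⟨.inr ⟨l, hy⟩, rfl⟩
  intro x y
  -- A path between indices of `Q` never leaves `Q`, so it lifts to the block.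
  obtain ⟨b, hb, hr⟩ := (hQ.reachable (hι x) (hι y)).induction_adj
    (fun z => ∃ b, ι b = z ∧ (zeroGraph (blockSubmatrix P Q)).Reachable x b)
    ⟨x, rfl, SimpleGraph.Reachable.refl _⟩ (by
      rintro _ z hz ⟨a, rfl, ha⟩
      obtain ⟨b, rfl⟩ := hsurj z
        ((hQ.indexMem_iff hz.reachable).mp (hι a))
      exact ⟨b, rfl, ha.trans (hadj a b hz).reachable⟩)
  rwa [← hinj hb]

end IsZeroClosure

/-- Pairs inside a closure are coloured as in its block, pairs in two different components of the
zero graph by the order of the components. -/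
theorem pairGraph_colorable (P : Matrix L I α) :
    (pairGraph P).Colorable
      (max 2 ((zeroClosures P).sup fun Q => degreeBound (blockSubmatrix P Q))) := by
  classical
  set K := max 2 ((zeroClosures P).sup fun Q => degreeBound (blockSubmatrix P Q)) with hK
  have hblock : ∀ Q, IsZeroClosure P Q → (pairGraph (blockSubmatrix P Q)).Colorable K :=
    fun Q hQ => (pairGraph_colorable_degreeBound hQ.preconnected hQ.exists_zero).mono
      (le_max_of_le_right (Finset.le_sup
        (f := fun Q => degreeBound (blockSubmatrix P Q)) (by simpa [zeroClosures] using hQ)))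
  have hcol : ∀ Q, IsZeroClosure P Q → ∃ f : I × L → Fin K, ∀ u v, (pairGraph P).Adj u v →
      indexMem Q (.inl u.1) → indexMem Q (.inr u.2) → f u ≠ f v := by
    intro Q hQ
    obtain ⟨C⟩ := hblock Q hQ
    -- The value 0 outside the block is arbitrary: neighbours of a position in the block stay in it.
    let f : I × L → Fin K := fun u =>
      if h : u.1 ∈ Q.1 ∧ u.2 ∈ Q.2 then C (⟨u.1, h.1⟩, ⟨u.2, h.2⟩) else ⟨0, by omega⟩
    refine ⟨f, fun u v huv h1 h2 => ?_⟩
    have h3 : v.1 ∈ Q.1 := (hQ.indexMem_iff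
      (SimpleGraph.Adj.reachable (zeroGraph_adj_inr_inl.mpr huv.2.1))).mp h2
    have h4 : v.2 ∈ Q.2 := (hQ.indexMem_iff
      (SimpleGraph.Adj.reachable (zeroGraph_adj_inl_inr.mpr huv.2.2))).mp h1
    have hu : f u = C (⟨u.1, h1⟩, ⟨u.2, h2⟩) := dif_pos ⟨h1, h2⟩
    have hv : f v = C (⟨v.1, h3⟩, ⟨v.2, h4⟩) := dif_pos ⟨h3, h4⟩
    rw [hu, hv]
    refine C.valid ⟨fun he => huv.1 ?_, huv.2⟩
    rw [Prod.mk.injEq] at he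
    exact Prod.ext (congrArg Subtype.val he.1) (congrArg Subtype.val he.2)
  choose f hf using hcol
  let comp := (zeroGraph P).connectedComponentMk
  obtain ⟨g, hg⟩ := exists_injective_nat (zeroGraph P).ConnectedComponent
  -- The injection `g` orders the components. Colours 0 and 1 exist because `K ≥ 2`, and may
  -- coincide with block colours since the two kinds of positions are never adjacent.
  let F : I × L → Fin K := fun u =>
    if h : ∃ Q, IsZeroClosure P Q ∧ indexMem Q (.inl u.1) ∧ indexMem Q (.inr u.2) then
      f h.choose h.choose_spec.1 u
    else if g (comp (.inl u.1)) < g (comp (.inr u.2)) then ⟨0, by omega⟩ else ⟨1, by omega⟩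
  refine ⟨SimpleGraph.Coloring.mk F fun {u v} huv => ?_⟩
  have hr1 : (zeroGraph P).Reachable (.inr u.2) (.inl v.1) :=
    SimpleGraph.Adj.reachable huv.2.1
  have hr2 : (zeroGraph P).Reachable (.inl u.1) (.inr v.2) :=
    SimpleGraph.Adj.reachable huv.2.2
  have hmove : ∀ Q, IsZeroClosure P Q →
      ((indexMem Q (.inl u.1) ∧ indexMem Q (.inr u.2)) ↔
        (indexMem Q (.inl v.1) ∧ indexMem Q (.inr v.2))) := fun Q hQ => by
    rw [hQ.indexMem_iff hr1, hQ.indexMem_iff hr2, and_comm]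
  by_cases h : ∃ Q, IsZeroClosure P Q ∧ indexMem Q (.inl u.1) ∧ indexMem Q (.inr u.2)
  · obtain ⟨Q, hQ, hmem⟩ := h
    have hF : ∀ w : I × L, indexMem Q (.inl w.1) ∧ indexMem Q (.inr w.2) → F w = f Q hQ w := by
      intro w hw
      have hex : ∃ Q, IsZeroClosure P Q ∧ indexMem Q (.inl w.1) ∧ indexMem Q (.inr w.2) :=
        ⟨Q, hQ, hw⟩
      have heq : hex.choose = Q :=
        hex.choose_spec.1.eq_of_indexMem hQ hex.choose_spec.2.1 hw.1
      change (if h : _ then _ else _) = _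
      rw [dif_pos hex]
      congr 1
    rw [hF u hmem, hF v ((hmove Q hQ).mp hmem)]
    exact hf Q hQ u v huv hmem.1 hmem.2
  · have h' : ¬ ∃ Q, IsZeroClosure P Q ∧ indexMem Q (.inl v.1) ∧ indexMem Q (.inr v.2) := by
      rintro ⟨Q, hQ, hmem⟩
      exact h ⟨Q, hQ, (hmove Q hQ).mpr hmem⟩
    have c1 : comp (.inr u.2) = comp (.inl v.1) := SimpleGraph.ConnectedComponent.sound hr1
    have c2 : comp (.inl u.1) = comp (.inr v.2) := SimpleGraph.ConnectedComponent.sound hr2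
    -- The row index of `u` lies on an edge, hence in some closure; a common component would place
    -- both indices of `u` in it.
    have hne : g (comp (.inl u.1)) ≠ g (comp (.inr u.2)) := by
      intro he
      have hr := SimpleGraph.ConnectedComponent.exact (hg he)
      obtain ⟨Q, hQ, -, hl⟩ := exists_isZeroClosure huv.2.1
      exact h ⟨Q, hQ, (hQ.indexMem_iff hr).mpr hl, hl⟩
    simp only [F, dif_neg h, dif_neg h', ← c1, ← c2]
    split_ifs with h1 h2 h2
    · omega
    · simp
    · simp
    · omega

end Closure

/-! ### From the semigroup to positions -/

namespace ReesZero

variable {G I L : Type*} [Group G] {P : Matrix L I (WithZero G)}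

theorem zero_mul' (a : ReesZero P) : (zero : ReesZero P) * a = zero := by
  cases a <;> rfl

theorem mul_zero' (a : ReesZero P) : a * (zero : ReesZero P) = zero := by
  cases a <;> rfl

theorem elem_mul_elem_of_eq_zero {i j : I} {l m : L} (x y : G) (h : P l j = 0) :
    (elem i x l : ReesZero P) * elem j y m = zero := by
  change mul _ _ = _
  simp [mul, h]

theorem elem_mul_elem_of_ne_zero {i j : I} {l m : L} (x y : G) (h : P l j ≠ 0) :
    (elem i x l : ReesZero P) * elem j y m = elem i (x * WithZero.unzero h * y) m := by
  change mul _ _ = _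
  simp [mul, h]

/-- Nonzero products retain the outer indices, so equal nonzero products force equal positions; a
zero product never equals a nonzero one. -/
theorem eq_or_eq_zero_of_commute {i j : I} {l m : L} {x y : G}
    (h : (elem i x l : ReesZero P) * elem j y m = elem j y m * elem i x l) :
    (i = j ∧ l = m) ∨ (P l j = 0 ∧ P m i = 0) := by
  by_cases h1 : P l j = 0 <;> by_cases h2 : P m i = 0
  · exact .inr ⟨h1, h2⟩
  · rw [elem_mul_elem_of_eq_zero x y h1, elem_mul_elem_of_ne_zero y x h2] at h
    simp at h
  · rw [elem_mul_elem_of_ne_zero x y h1, elem_mul_elem_of_eq_zero y x h2] at h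
    simp at h
  · rw [elem_mul_elem_of_ne_zero x y h1, elem_mul_elem_of_ne_zero y x h2] at h
    simp only [elem.injEq] at h
    exact .inl ⟨h.1, h.2.2.symm⟩

theorem zero_mem_center : (zero : ReesZero P) ∈ Set.center (ReesZero P) :=
  Semigroup.mem_center_iff.mpr fun a => by rw [zero_mul', mul_zero']

/-- Commuting with elements placed at nonzero entries of row `l` and column `i` would leave only one
row and one column, whose single entry would be both zero and nonzero. -/
theorem elem_notMem_center (hreg : IsRegularMatrix P) (hzero : ∃ l i, P l i = 0)
    (i : I) (x : G) (l : L) : (elem i x l : ReesZero P) ∉ Set.center (ReesZero P) := by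
  intro h
  rw [Semigroup.mem_center_iff] at h
  obtain ⟨j, hj⟩ := hreg.1 l
  obtain ⟨m, hm⟩ := hreg.2 i
  have hL : ∀ l', l' = l := fun l' => by
    rcases eq_or_eq_zero_of_commute (h (elem j 1 l')) with h' | h'
    · exact h'.2
    · exact absurd h'.2 hj
  have hI : ∀ i', i' = i := fun i' => by
    rcases eq_or_eq_zero_of_commute (h (elem i' 1 m)) with h' | h'
    · exact h'.1
    · exact absurd h'.1 hm
  obtain ⟨l₀, i₀, h₀⟩ := hzero
  rw [hL l₀, hI i₀] at h₀
  rw [hI j] at hj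
  exact hj h₀

theorem exists_eq_elem_of_notMem_center {a : ReesZero P} (ha : a ∉ Set.center (ReesZero P)) :
    ∃ i x l, a = elem i x l := by
  obtain _ | ⟨i, x, l⟩ := a
  · exact absurd zero_mem_center ha
  · exact ⟨i, x, l, rfl⟩

theorem chromaticNumber_commutingGraph_le [Fintype G] {k : ℕ} (h : (pairGraph P).Colorable k) :
    (commutingGraph (ReesZero P)).chromaticNumber ≤ (k * Fintype.card G : ℕ) := by
  obtain ⟨C⟩ := h
  choose i x l hil using
    fun a : {a : ReesZero P // a ∉ Set.center (ReesZero P)} => exists_eq_elem_of_notMem_center a.2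
  let D : (commutingGraph (ReesZero P)).Coloring (Fin k × G) :=
    SimpleGraph.Coloring.mk (fun a => (C (i a, l a), x a)) (by
      intro a b hab he
      obtain ⟨hne, hcomm⟩ := hab
      rw [hil a, hil b] at hcomm
      simp only [Prod.mk.injEq] at he
      by_cases hpos : i a = i b ∧ l a = l b
      · exact hne (Subtype.ext (by rw [hil a, hil b, hpos.1, hpos.2, he.2]))
      · have hz := (eq_or_eq_zero_of_commute hcomm).resolve_left hpos
        exact C.valid ⟨fun hp => hpos (by simpa using hp), hz⟩ he.1)
  have hcol := D.colorable
  rw [Fintype.card_prod, Fintype.card_fin] at hcol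
  exact hcol.chromaticNumber_le

/-- Along a path of commuting elements from position `(i₀, l₀)`, each step either keeps the position
or joins each new index to an old one by an edge, so every index is reachable from `i₀`. -/
theorem zeroGraph_preconnected (hreg : IsRegularMatrix P) (hzero : ∃ l i, P l i = 0)
    (hconn : (commutingGraph (ReesZero P)).Connected) : (zeroGraph P).Preconnected := by
  have hnc := elem_notMem_center hreg hzero
  obtain ⟨l₀, i₀, h₀⟩ := hzero
  have key : ∀ (i : I) (l : L), (zeroGraph P).Reachable (.inl i₀) (.inl i) ∧
      (zeroGraph P).Reachable (.inl i₀) (.inr l) := by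
    intro i l
    have := (hconn.preconnected ⟨elem i₀ 1 l₀, hnc i₀ 1 l₀⟩ ⟨elem i 1 l, hnc i 1 l⟩).induction_adj
      (fun a => ∀ j y m, (a : ReesZero P) = elem j y m →
        (zeroGraph P).Reachable (.inl i₀) (.inl j) ∧ (zeroGraph P).Reachable (.inl i₀) (.inr m))
      (by
        intro j y m he
        simp only [elem.injEq] at he
        obtain ⟨rfl, -, rfl⟩ := he
        exact ⟨SimpleGraph.Reachable.refl _, SimpleGraph.Adj.reachable h₀⟩)
      (by
        rintro ⟨a, ha⟩ ⟨b, hb⟩ ⟨-, hcomm⟩ ih j y m rfl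
        obtain ⟨j', y', m', rfl⟩ := exists_eq_elem_of_notMem_center ha
        obtain ⟨h1, h2⟩ := ih j' y' m' rfl
        rcases eq_or_eq_zero_of_commute hcomm with ⟨rfl, rfl⟩ | ⟨z1, z2⟩
        · exact ⟨h1, h2⟩
        · exact ⟨h2.trans (SimpleGraph.Adj.reachable z1), h1.trans (SimpleGraph.Adj.reachable z2)⟩)
    exact this i 1 l rfl
  have key' : ∀ z, (zeroGraph P).Reachable (.inl i₀) z := by
    rintro (i | l)
    · exact (key i l₀).1
    · exact (key i₀ l).2
  exact fun a b => (key' a).symm.trans (key' b)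

end ReesZero

theorem mainTheorem7 {G I L : Type*} [Group G] [Fintype G] [Fintype I] [Fintype L]
    (P : Matrix L I (WithZero G)) (hreg : IsRegularMatrix P) (hzero : ∃ l i, P l i = 0) :
    ((commutingGraph (ReesZero P)).Connected →
      (HasNonzeroAtMax P →
        (commutingGraph (ReesZero P)).chromaticNumber ≤
          (maxColZeros P * maxRowZeros P * Fintype.card G : ℕ)) ∧
      (¬ HasNonzeroAtMax P →
        (commutingGraph (ReesZero P)).chromaticNumber ≤
          ((maxColZeros P * maxRowZeros P - 1) * Fintype.card G : ℕ))) ∧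
    (¬ (commutingGraph (ReesZero P)).Connected →
      (commutingGraph (ReesZero P)).chromaticNumber ≤
        (max 2 ((zeroClosures P).sup fun Q => degreeBound (blockSubmatrix P Q)) *
          Fintype.card G : ℕ)) := by
  refine ⟨fun hconn => ?_, fun _ =>
    ReesZero.chromaticNumber_commutingGraph_le (pairGraph_colorable P)⟩
  have hpre := ReesZero.zeroGraph_preconnected hreg hzero hconn
  refine ⟨fun _ => ReesZero.chromaticNumber_commutingGraph_le (pairGraph_colorable_mul hpre),
    fun hmax => ReesZero.chromaticNumber_commutingGraph_le
      (pairGraph_colorable_mul_sub_one hpre hzero ?_ hmax)⟩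
  -- Regularity excludes the zero matrix.
  rintro rfl
  obtain ⟨l, -, -⟩ := hzero
  obtain ⟨i, hi⟩ := hreg.1 l
  exact hi rfl
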